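/- **Setting.** Let $M\ge 2$ and $1\le T\le N$ be integers. There are $N$ servers, each storing the same $M$ files $W_1,\dots,W_M$. Each file consists of $L=N^M$ segments, and all segments are independent and uniform on a finite nonzero vector space $\mathcal A$ over a finite field $\mathbb F$ (for instance $\mathcal A=\mathbb F$). The desired index $\theta$ is uniform on $[1:M]$. In an information retrieval scheme the client sends random queries $Q_l^\theta$ to the servers $l\in[0:N-1]$ (generated from $\theta$ and private randomness, independently of the files), and server $l$ returns a string $A^\theta_l$ of symbols of $\mathcal A$ that is a function of its query and of the files. The scheme is correct if $H(W_k\mid A^k_{[0:N-1]},Q^k_{[0:N-1]})=0$ for every $k\in[1:M]$. Its rate is $R=L\log|\mathcal A|/\mathbb E[D]$, where $D$ is the total number of downloaded bits, and its mutual information leakage under $T$-collusion is $$\rho^{\mathsf{MIL}}=\binom NT^{-1}\sum_{\mathcal T\subseteq[0:N-1],\,|\mathcal T|=T} I(\theta;Q^\theta_{\mathcal T}),\qquad Q^\theta_{\mathcal T}=(Q^\theta_t)_{t\in\mathcal T}.$$ All logarithms are to base $2$. **The $T$-colluding Sun–Jafar scheme** on a set $K$ of $s\ge 2$ files with desired file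 $l\in K$. Each file is regarded as a vector of $N^s$ super-segments, each consisting of $N^{M-s}$ consecutive segments. The client draws independent uniformly random invertible $N^s\times N^s$ matrices $S_k$ over $\mathbb F$, $k\in K$. For each nonempty $V\subseteq K$ and $k\in V$ there is a vector $x^{(k)}_V$ of $N(N-T)^{|V|-1}T^{s-|V|}$ symbols. The vectors $x^{(l)}_V$, $l\in V\subseteq K$, stacked, form $S_lW_l$. For $k\ne l$ and each $U\subseteq K$ with $k\in U\not\ni l$, the stacked vector $(x^{(k)}_U,x^{(k)}_{U\cup\{l\}})$ is the encoding by an MDS code of $\alpha=N(N-T)^{|U|-1}T^{s-|U|}$ of the entries of $S_kW_k$, where disjoint sets of entries are used for different $U$, and where the code has length $\frac NT\alpha$, dimension $\alpha$ and a generator matrix over $\mathbb F$ that depends only on $(s,|U|)$, any $\alpha$ rows of which form an invertible matrix. For every $V$, the symbols of $\sum_{k\in V}x^{(k)}_V$ are distributed evenly among the $N$ servers; a query is the list of the coefficients of the linear combinations requested from that server, and the server returns their values. **The scheme $\mathcal P_{T-\mathsf{WSJ}}$.** Given $\theta=k$, the client draws $M'\in[0:M-1]$ from a chosen distribution $\mathsf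 P_{M'}$. If $M'=0$, a uniformly random server gets the query $\#_k$ and returns the whole of $W_k$, and all other servers get the null query $\phi$ and return nothing. If $M'=m'\neq0$, the client draws a uniformly random set $J$ of $m'$ file indices other than $k$ and runs the $T$-colluding Sun–Jafar scheme on $K=J\cup\{k\}$ with desired file $k$. **Theorem.** Let $M\ge2$ and $1\le T\le N$. There is $q_0$ such that for every $\rho\ge0$ there is a distribution $\mathsf P_{M'}$ on $[0:M-1]$ such that, for every finite field $\mathbb F$ with $|\mathbb F|\ge q_0$ and every $\mathcal A$ as above, MDS generator matrices as required exist over $\mathbb F$, and for every choice of them the scheme $\mathcal P_{T-\mathsf{WSJ}}$ is correct and achieves $$\rho^{\mathsf{MIL}}=\min\Bigl(\rho,\frac{T\log M}{N}\Bigr),\qquad R=\left(1+\Bigl(1-\frac{N\rho}{T\log M}\Bigr)_+\Bigl(\frac TN+\cdots+\Bigl(\frac TN\Bigr)^{M-1}\Bigr)\right)^{-1},$$ where $(x)_+=\max(0,x)$. -/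

import Mathlib

open Finset

noncomputable section

/-! ### Entropy of finitely supported laws, logarithms in base two -/

/-- Shannon entropy, in bits, of a probability law on a finite type. -/
def shannonEntropy {α : Type*} [Finite α] (p : PMF α) : ℝ :=
  ∑' a, Real.negMulLog (p a).toReal / Real.log 2

/-- `I(X ; Y) = H(X) + H(Y) - H(X, Y)` for the joint law `p` of `(X, Y)`. -/
def mutualInfo {α β : Type*} [Finite α] [Finite β] (p : PMF (α × β)) : ℝ :=
  shannonEntropy (p.map Prod.fst) + shannonEntropy (p.map Prod.snd) - shannonEntropy p

/-- `H(X | Y) = H(X, Y) - H(Y)` for the joint law `p` of `(X, Y)`. -/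
def condEntropy {α β : Type*} [Finite α] [Finite β] (p : PMF (α × β)) : ℝ :=
  shannonEntropy p - shannonEntropy (p.map Prod.snd)

/-- The uniform law on a nonempty finite type. -/
def uniformLaw (α : Type*) [Finite α] [Nonempty α] : PMF α :=
  letI := Fintype.ofFinite α
  PMF.uniformOfFintype α

/-! ### Information retrieval schemes with replicated servers -/

/-- An information retrieval scheme with `M` files of `L` symbols from the alphabet `A`, replicated
on `N` servers. `queryLaw k` is the joint law (over the private randomness of the client) of the
queries sent to the `N` servers when the file `k` is desired. Server `n` answers the query `q` with
a tuple of symbols of `A`, indexed by `AnsIdx n q`, which is a function of `q` and of the files. -/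
structure IRScheme (M N L : ℕ) (A : Type*) where
  Query : Type*
  finiteQuery : Finite Query
  queryLaw : Fin M → PMF (Fin N → Query)
  AnsIdx : Fin N → Query → Type
  finiteAnsIdx : ∀ n q, Finite (AnsIdx n q)
  answer : ∀ (n : Fin N) (q : Query), (Fin M → Fin L → A) → AnsIdx n q → A

namespace IRScheme

variable {M N L : ℕ} {A : Type*}

instance (C : IRScheme M N L A) : Finite C.Query := C.finiteQuery

instance (C : IRScheme M N L A) (n : Fin N) (q : C.Query) : Finite (C.AnsIdx n q) :=
  C.finiteAnsIdx n q

/-- Everything the client receives or generates: the queries together with the answers. -/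
abbrev Transcript (C : IRScheme M N L A) : Type _ :=
  Σ q : Fin N → C.Query, ∀ n, C.AnsIdx n (q n) → A

/-- The joint law of `(W_k, (Q^k, A^k))` when the file `k` is desired; the files are independent and
uniformly distributed, and independent of the queries. -/
def fileTranscriptLaw [Finite A] [Nonempty A] (C : IRScheme M N L A) (k : Fin M) :
    PMF ((Fin L → A) × C.Transcript) :=
  (uniformLaw (Fin M → Fin L → A)).bind fun W =>
    (C.queryLaw k).map fun q => (W k, ⟨q, fun n => C.answer n (q n) W⟩)

/-- Correctness: `H(W_k | A^k, Q^k) = 0` for every desired index `k`. -/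
def Correct [Finite A] [Nonempty A] (C : IRScheme M N L A) : Prop :=
  ∀ k : Fin M, condEntropy (C.fileTranscriptLaw k) = 0

/-- The joint law of `(θ, Q^θ)`, with `θ` uniform on the file indices. -/
def indexQueryLaw [NeZero M] (C : IRScheme M N L A) : PMF (Fin M × (Fin N → C.Query)) :=
  (uniformLaw (Fin M)).bind fun k => (C.queryLaw k).map fun q => (k, q)

/-- `I(θ ; Q^θ_𝒯)`: what the servers in `𝒯` jointly learn about the desired index. -/
def leakage [NeZero M] (C : IRScheme M N L A) (𝒯 : Finset (Fin N)) : ℝ :=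
  mutualInfo (C.indexQueryLaw.map fun x => (x.1, fun t : 𝒯 => x.2 t))

/-- The mutual information leakage, averaged over all sets of `T` servers. -/
def milLeakage [NeZero M] (C : IRScheme M N L A) (T : ℕ) : ℝ :=
  (1 / (N.choose T : ℝ)) * ∑ 𝒯 ∈ powersetCard T (univ : Finset (Fin N)), C.leakage 𝒯

/-- The total number of bits downloaded when the queries are `q`. -/
def downloadBits (C : IRScheme M N L A) (q : Fin N → C.Query) : ℝ :=
  ∑ n, (Nat.card (C.AnsIdx n (q n)) : ℝ) * Real.logb 2 (Nat.card A)

/-- The rate `L log |A| / E[D]`. -/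
def rate [NeZero M] (C : IRScheme M N L A) : ℝ :=
  (L : ℝ) * Real.logb 2 (Nat.card A) /
    ∑' x, (C.indexQueryLaw x).toReal * C.downloadBits x.2

end IRScheme

/-! ### The Sun-Jafar query generation for `T` colluding servers -/

/-- In the scheme on `s` files, the number of symbols of each type (a type is a set of `i` files)
requested from each server. -/
def symbolCount (N T s i : ℕ) : ℕ := (N - T) ^ (i - 1) * T ^ (s - i)

/-- A choice of the MDS codes used by the client: for every number `s` of files and every
`1 ≤ i < s`, a generator matrix with `α = N * symbolCount N T s i` columns and `(N / T) * α` rows,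
any `α` rows of which form an invertible matrix. The rows `Sum.inl (n, j)` and `Sum.inr (n, j)` give
the code symbols that are sent to server `n`, alone and mixed with desired symbols. -/
structure MDSFamily (N T M : ℕ) (F : Type*) [Field F] where
  gen : ∀ s i : ℕ, Matrix
    ((Fin N × Fin (symbolCount N T s i)) ⊕ (Fin N × Fin (symbolCount N T s (i + 1))))
    (Fin N × Fin (symbolCount N T s i)) F
  isMDS : ∀ s i : ℕ, 1 ≤ i → i < s → s ≤ M →
    ∀ f : (Fin N × Fin (symbolCount N T s i)) ↪
      ((Fin N × Fin (symbolCount N T s i)) ⊕ (Fin N × Fin (symbolCount N T s (i + 1)))),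
    ((gen s i).submatrix f id).det ≠ 0

/-- Labels of the rows of the random matrix of file `k`: a type `V ∋ k`, a server and a position. -/
abbrev RowIdx {M : ℕ} (N T : ℕ) (K : Finset (Fin M)) (k : Fin M) : Type :=
  Σ V : {V : Finset (Fin M) // V ⊆ K ∧ k ∈ V}, Fin N × Fin (symbolCount N T K.card V.1.card)

theorem card_rowIdx {M N T : ℕ} (hTN : T ≤ N) {K : Finset (Fin M)} {k : Fin M} (hk : k ∈ K) :
    Fintype.card (RowIdx N T K k) = N ^ K.card := by
  classical
  have h1 : Fintype.card (RowIdx N T K k) =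
      ∑ V : {V : Finset (Fin M) // V ⊆ K ∧ k ∈ V}, N * symbolCount N T K.card V.1.card := by
    simp [RowIdx]
  have h2 : (∑ V : {V : Finset (Fin M) // V ⊆ K ∧ k ∈ V}, N * symbolCount N T K.card V.1.card) =
      ∑ U ∈ (K.erase k).powerset, N * ((N - T) ^ U.card * T ^ ((K.erase k).card - U.card)) := by
    symm
    refine Finset.sum_bij
      (fun U hU => (⟨insert k U, insert_subset hk ((mem_powerset.1 hU).trans (erase_subset _ _)),
        mem_insert_self _ _⟩ : {V : Finset (Fin M) // V ⊆ K ∧ k ∈ V}))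
      (fun _ _ => mem_univ _) ?_ ?_ ?_
    · intro U hU U' hU' h
      have hkU : k ∉ U := fun h => by simpa using mem_powerset.1 hU h
      have hkU' : k ∉ U' := fun h => by simpa using mem_powerset.1 hU' h
      have h' : insert k U = insert k U' := congrArg Subtype.val h
      rw [← erase_insert hkU, h', erase_insert hkU']
    · rintro ⟨V, hVK, hkV⟩ -
      exact ⟨V.erase k, mem_powerset.2 (erase_subset_erase _ hVK),
        Subtype.ext (insert_erase hkV)⟩
    · intro U hU
      have hkU : k ∉ U := fun h => by simpa using mem_powerset.1 hU h
      have e : K.card - (U.card + 1) = K.card - 1 - U.card := by omega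
      simp [symbolCount, card_insert_of_notMem hkU, card_erase_of_mem hk, e]
  rw [h1, h2, ← Finset.mul_sum, Finset.sum_pow_mul_eq_add_pow, Nat.sub_add_cancel hTN,
    ← pow_succ', card_erase_add_one hk]

/-- A numbering of the row labels. -/
def rowEquiv {M N T : ℕ} (hTN : T ≤ N) {K : Finset (Fin M)} {k : Fin M} (hk : k ∈ K) :
    RowIdx N T K k ≃ Fin (N ^ K.card) :=
  Fintype.equivFinOfCardEq (card_rowIdx hTN hk)

/-- The nonempty sets of files of `K`, which are the types of the requested sums. -/
abbrev SumType {M : ℕ} (K : Finset (Fin M)) : Type := {V : Finset (Fin M) // V ⊆ K ∧ V.Nonempty}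

/-- A query of the Sun-Jafar scheme on the set `K` of files to one server: for every type `V` and
every position, the coefficients, file by file and super-segment by super-segment, of the linear
combination that the server has to return. -/
abbrev LinQuery {M : ℕ} (N T : ℕ) (F : Type*) (K : Finset (Fin M)) : Type _ :=
  ∀ V : SumType K, Fin (symbolCount N T K.card V.1.card) → Fin M → Fin (N ^ K.card) → F

/-- The Sun-Jafar queries on the set `K` of files, with desired file `l` and matrices `S`.
For a type `V` and a file `k ∈ V`:
* if `k = l`, the requested symbols are `S l * W_l`, each row of `S l` being used once;
* if `k ≠ l` and `l ∉ V`, they are the first code symbols of the MDS code applied to the rows of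
  `S k` labelled by `V`;
* if `k ≠ l` and `l ∈ V`, they are the remaining code symbols of the code word for `V \ {l}`.
Server `n` is asked for the sum of these symbols over `k ∈ V`, at each of its positions. -/
def sunJafarQuery {M N T : ℕ} (hTN : T ≤ N) {F : Type*} [Field F] (G : MDSFamily N T M F)
    (K : Finset (Fin M)) (l : Fin M)
    (S : Fin M → Matrix.GeneralLinearGroup (Fin (N ^ K.card)) F) (n : Fin N) :
    LinQuery N T F K := fun V j k c =>
  if hk : k ∈ V.1 then
    if k = l then
      (S k).1 (rowEquiv hTN (V.2.1 hk) ⟨⟨V.1, V.2.1, hk⟩, n, j⟩) c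
    else if hl : l ∈ V.1 then
      if hkl : k ∈ V.1.erase l then
        ∑ r, G.gen K.card (V.1.erase l).card
            (Sum.inr (n, Fin.cast (by rw [card_erase_add_one hl]) j)) r *
          (S k).1 (rowEquiv hTN (V.2.1 hk)
            ⟨⟨V.1.erase l, (erase_subset _ _).trans V.2.1, hkl⟩, r⟩) c
      else 0
    else
      ∑ r, G.gen K.card V.1.card (Sum.inl (n, j)) r *
        (S k).1 (rowEquiv hTN (V.2.1 hk) ⟨⟨V.1, V.2.1, hk⟩, r⟩) c
  else 0

/-! ### The weakly private scheme -/

/-- Queries: the null query `φ`, the clean download query `#_k`, or a Sun-Jafar query on the set `K`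
of files. -/
inductive WQuery (M N T : ℕ) (F : Type*)
  | null : WQuery M N T F
  | clean (k : Fin M) : WQuery M N T F
  | lin (K : Finset (Fin M)) (c : LinQuery N T F K) : WQuery M N T F

instance {M N T : ℕ} {F : Type*} [Finite F] : Finite (WQuery M N T F) := by
  let f : Unit ⊕ Fin M ⊕ (Σ K : Finset (Fin M), LinQuery N T F K) → WQuery M N T F
    | Sum.inl _ => .null
    | Sum.inr (Sum.inl k) => .clean k
    | Sum.inr (Sum.inr ⟨K, c⟩) => .lin K c
  refine Finite.of_surjective f ?_
  rintro (_ | k | ⟨K, c⟩)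
  · exact ⟨Sum.inl (), rfl⟩
  · exact ⟨Sum.inr (Sum.inl k), rfl⟩
  · exact ⟨Sum.inr (Sum.inr ⟨K, c⟩), rfl⟩

/-- The sets of `m` file indices other than `k`. -/
theorem otherFiles_nonempty {M : ℕ} (k m : Fin M) :
    (powersetCard (m : ℕ) (univ.erase k)).Nonempty := by
  rw [powersetCard_nonempty, card_erase_of_mem (mem_univ k), card_univ, Fintype.card_fin]
  omega

/-- The law of the queries when file `k` is desired and `M'` has law `P`. If `M' = 0`, a uniformly
random server gets `#_k` and the others get `φ`. If `M' = m ≠ 0`, a uniformly random set `J` of `m`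
other files is drawn, and the Sun-Jafar queries on `J ∪ {k}` are generated with independent uniformly
random invertible matrices. -/
def wQueryLaw {M N T : ℕ} [NeZero N] (hTN : T ≤ N) {F : Type*} [Field F] [Finite F]
    (G : MDSFamily N T M F) (P : PMF (Fin M)) (k : Fin M) : PMF (Fin N → WQuery M N T F) :=
  P.bind fun m =>
    if (m : ℕ) = 0 then
      (uniformLaw (Fin N)).map fun s n => if n = s then .clean k else .null
    else
      (PMF.uniformOfFinset (powersetCard (m : ℕ) (univ.erase k)) (otherFiles_nonempty k m)).bind
        fun J => (uniformLaw (Fin M →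
            Matrix.GeneralLinearGroup (Fin (N ^ (insert k J).card)) F)).map
          fun S n => .lin (insert k J) (sunJafarQuery hTN G (insert k J) k S n)

/-- Segment number `r` of the super-segment number `c`: the `N ^ M` segments of a file are cut, in
order, into `N ^ |K|` super-segments of `N ^ (M - |K|)` consecutive segments. -/
def segmentIdx {M : ℕ} (N : ℕ) (K : Finset (Fin M)) (c : Fin (N ^ K.card))
    (r : Fin (N ^ (M - K.card))) : Fin (N ^ M) :=
  Fin.cast (by
    rw [← pow_add, Nat.add_sub_cancel' (by simpa using card_le_univ K)]) (finProdFinEquiv (c, r))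

/-- The index set of the symbols of the answer to a query. -/
def WAnsIdx {M N T : ℕ} {F : Type*} : WQuery M N T F → Type
  | .null => Empty
  | .clean _ => Fin (N ^ M)
  | .lin K _ => Σ V : SumType K, Fin (symbolCount N T K.card V.1.card) × Fin (N ^ (M - K.card))

/-- The answer of a server: nothing to `φ`, the whole file to `#_k`, and the requested linear
combinations of super-segments to a Sun-Jafar query. -/
def wAnswer {M N T : ℕ} {F : Type*} [Field F] {A : Type*} [AddCommGroup A] [Module F A] :
    ∀ q : WQuery M N T F, (Fin M → Fin (N ^ M) → A) → WAnsIdx q → A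
  | .null, _ => fun i => nomatch i
  | .clean k, W => W k
  | .lin K c, W => fun i => ∑ k, ∑ d, c i.1 i.2.1 k d • W k (segmentIdx N K d i.2.2)

/-- The weakly private information retrieval scheme for `T` colluding servers which uses the MDS
codes `G` and the law `P` of `M'`; the segments of the files are elements of `A`. -/
def tWSJ {M N T : ℕ} [NeZero N] (hTN : T ≤ N) {F : Type*} [Field F] [Finite F]
    (A : Type*) [AddCommGroup A] [Module F A] (G : MDSFamily N T M F) (P : PMF (Fin M)) :
    IRScheme M N (N ^ M) A where
  Query := WQuery M N T F
  finiteQuery := inferInstance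
  queryLaw := wQueryLaw hTN G P
  AnsIdx := fun _ q => WAnsIdx q
  finiteAnsIdx := by
    rintro _ (_ | k | ⟨K, c⟩) <;> unfold WAnsIdx <;> infer_instance
  answer := fun _ q W => wAnswer q W

end

/-! Only the two extreme values of $M'$ are used: a clean download ($M'=0$) with probability $p$,
and the Sun–Jafar scheme on all $M$ files ($M'=M-1$) with probability $1-p$. Both leakage and
expected download are affine in $p$, and $p=\min(1,N\rho/(T\log M))$ gives the asserted values.

Leakage: a clean query tells a set of $T$ servers the index, and reaches one of them with
probability $pT/N$. Every other observation must be equally likely for all indices, so that the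
information is $p\frac TN\log M$ (`mutualInfo_of_reveal`). For this, the Sun–Jafar queries
restricted to $T$ servers must have a law free of the desired index. From each code word these
servers see exactly as many symbols as its dimension (`mul_symbolCount_add`), so by the MDS property
what they see of an undesired file is a family of independent combinations of rows of $S_k$, and
hence rows of $B_kS_k$ with $B_k$ invertible and independent of $S$ (`exists_GL_mul_row_eq`). Left
multiplication by $B_k$ preserves the uniform law.

Correctness: answers are linear in the files, so it suffices that vanishing answers force the
desired file to vanish. All files share one code per type, hence the interference is itself a code
word; it is determined by its part in the sums without the desired file (`rowValue_self_eq_zero`).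

Rate: a recursion on the number of files gives $L\sum_{i<s}(T/N)^i$ symbols for the Sun–Jafar scheme
on $s$ files (`sum_powerset_symbolCount`), against $L$ for a clean download. Vandermonde matrices
supply the codes once the field has as many elements as the longest code has symbols. -/

noncomputable section

/-! ### Expectations and entropies of laws on finite types -/

/-- The expectation of a real function under a law. -/
def PMF.expect {α : Type*} (p : PMF α) (f : α → ℝ) : ℝ := ∑' a, (p a).toReal * f a

theorem PMF.sum_toReal {α : Type*} [Fintype α] (p : PMF α) : ∑ a, (p a).toReal = 1 := by
  rw [← ENNReal.toReal_sum (fun a _ => p.apply_ne_top a), ← tsum_fintype (L := .unconditional α),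
    p.tsum_coe, ENNReal.toReal_one]

theorem PMF.bind_apply_toReal {α β : Type*} [Fintype α] (p : PMF α) (g : α → PMF β) (b : β) :
    (p.bind g b).toReal = ∑ a, (p a).toReal * (g a b).toReal := by
  rw [PMF.bind_apply, tsum_fintype, ENNReal.toReal_sum]
  · simp
  · exact fun a _ => ENNReal.mul_ne_top (p.apply_ne_top a) ((g a).apply_ne_top b)

theorem PMF.expect_bind {α β : Type*} [Finite α] [Finite β] (p : PMF α) (g : α → PMF β)
    (f : β → ℝ) : (p.bind g).expect f = p.expect fun a => (g a).expect f := by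
  have := Fintype.ofFinite α
  have := Fintype.ofFinite β
  simp only [PMF.expect, tsum_fintype, PMF.bind_apply_toReal, Finset.sum_mul, Finset.mul_sum]
  rw [Finset.sum_comm]
  simp only [mul_assoc]

theorem PMF.expect_const_of_support {α : Type*} [Finite α] (p : PMF α) {f : α → ℝ} {c : ℝ}
    (h : ∀ a ∈ p.support, f a = c) : p.expect f = c := by
  have := Fintype.ofFinite α
  have h1 : ∀ a, (p a).toReal * f a = (p a).toReal * c := by
    intro a
    by_cases ha : p a = 0
    · simp [ha]
    · rw [h a ((p.mem_support_iff a).2 ha)]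
  simp only [PMF.expect, h1, tsum_fintype, ← Finset.sum_mul, p.sum_toReal, one_mul]

theorem PMF.expect_pure {α : Type*} [Finite α] (a : α) (f : α → ℝ) :
    (PMF.pure a).expect f = f a :=
  PMF.expect_const_of_support _ fun b hb => by
    rw [PMF.support_pure, Set.mem_singleton_iff] at hb
    rw [hb]

theorem PMF.expect_map {α β : Type*} [Finite α] [Finite β] (p : PMF α) (g : α → β)
    (f : β → ℝ) : (p.map g).expect f = p.expect fun a => f (g a) := by
  simp only [PMF.map, PMF.expect_bind, Function.comp_apply, PMF.expect_pure]

theorem uniformLaw_apply_toReal {α : Type*} [Fintype α] [Nonempty α] (a : α) :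
    (uniformLaw α a).toReal = (Fintype.card α : ℝ)⁻¹ := by
  simp only [uniformLaw, PMF.uniformOfFintype_apply, ENNReal.toReal_inv, ENNReal.toReal_natCast]
  congr!

theorem shannonEntropy_eq_sum {α : Type*} [Fintype α] (p : PMF α) :
    shannonEntropy p = (∑ a, Real.negMulLog (p a).toReal) / Real.log 2 := by
  rw [shannonEntropy, tsum_fintype, Finset.sum_div]

theorem PMF.map_fst_apply_toReal {α β : Type*} [Fintype α] [Fintype β] (p : PMF (α × β)) (a : α) :
    (p.map Prod.fst a).toReal = ∑ b, (p (a, b)).toReal := by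
  classical
  rw [PMF.map_apply, tsum_fintype, Fintype.sum_prod_type, ENNReal.toReal_sum]
  · rw [Finset.sum_eq_single a]
    · simp [ENNReal.toReal_sum, PMF.apply_ne_top]
    · intro b _ hb
      simp [hb.symm]
    · simp
  · intro a' _
    refine ENNReal.sum_ne_top.2 fun b _ => ?_
    split_ifs
    exacts [PMF.apply_ne_top _ _, ENNReal.zero_ne_top]

theorem PMF.map_snd_apply_toReal {α β : Type*} [Fintype α] [Fintype β] (p : PMF (α × β)) (b : β) :
    (p.map Prod.snd b).toReal = ∑ a, (p (a, b)).toReal := by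
  classical
  rw [PMF.map_apply, tsum_fintype, Fintype.sum_prod_type, ENNReal.toReal_sum]
  · refine Finset.sum_congr rfl fun a _ => ?_
    simp
  · intro a' _
    refine ENNReal.sum_ne_top.2 fun b _ => ?_
    split_ifs
    exacts [PMF.apply_ne_top _ _, ENNReal.zero_ne_top]

/-- A variable which is almost surely a function of `Y` has no entropy given `Y`. -/
theorem condEntropy_eq_zero_of_support {α β : Type*} [Finite α] [Finite β] (p : PMF (α × β))
    (h : ∀ x ∈ p.support, ∀ y ∈ p.support, x.2 = y.2 → x.1 = y.1) : condEntropy p = 0 := by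
  classical
  have := Fintype.ofFinite α
  have := Fintype.ofFinite β
  -- Each fibre carries at most one atom, so both sides have the same single term.
  have key : ∀ b, ∑ a, Real.negMulLog (p (a, b)).toReal =
      Real.negMulLog (∑ a, (p (a, b)).toReal) := by
    intro b
    by_cases hb : ∃ a, p (a, b) ≠ 0
    · obtain ⟨a, ha⟩ := hb
      have h0 : ∀ a', a' ≠ a → p (a', b) = 0 := by
        intro a' ha'
        by_contra hne
        exact ha' (h (a', b) ((p.mem_support_iff _).2 hne) (a, b) ((p.mem_support_iff _).2 ha) rfl)
      rw [Finset.sum_eq_single a, Finset.sum_eq_single a]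
      all_goals simp +contextual [h0]
    · push Not at hb
      simp [hb]
  rw [condEntropy, shannonEntropy_eq_sum, shannonEntropy_eq_sum, Fintype.sum_prod_type_right]
  simp only [PMF.map_snd_apply_toReal, key, sub_self]

/-- The mutual information between a uniform index `k` and an observation of law `r k`, when each
observation outside the set `S` reveals the index and each observation in `S` is equally likely for
all indices. -/
theorem mutualInfo_of_reveal {ι β : Type*} [Fintype ι] [Nonempty ι] [Finite β] (r : ι → PMF β)
    (S : Set β) [DecidablePred (· ∈ S)] {c : ℝ}
    (hin : ∀ y ∈ S, ∀ k k', r k y = r k' y)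
    (hout : ∀ y ∉ S, ∀ k k', r k y ≠ 0 → r k' y ≠ 0 → k = k')
    (hc : ∀ k, (r k).expect (fun y => if y ∈ S then 0 else 1) = c) :
    mutualInfo ((uniformLaw ι).bind fun k => (r k).map fun y => (k, y)) =
      c * Real.logb 2 (Fintype.card ι) := by
  classical
  have := Fintype.ofFinite β
  set p := (uniformLaw ι).bind fun k => (r k).map fun y => (k, y) with hp
  set m : ℝ := (Fintype.card ι : ℝ) with hm
  have hm0 : m ≠ 0 := by simp [hm]
  have hpa : ∀ k y, (p (k, y)).toReal = m⁻¹ * (r k y).toReal := by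
    intro k y
    rw [hp, PMF.bind_apply_toReal, Finset.sum_eq_single k]
    · rw [uniformLaw_apply_toReal, PMF.map_apply, tsum_eq_single y]
      · simp [hm]
      · intro y' hy'
        simp [hy'.symm]
    · intro k' _ hk'
      have : (PMF.map (fun y => (k', y)) (r k')) (k, y) = 0 := by
        rw [PMF.map_apply]
        simp [hk'.symm]
      simp [this]
    · simp
  have h1 : shannonEntropy (p.map Prod.fst) = Real.logb 2 m := by
    rw [shannonEntropy_eq_sum]
    simp only [PMF.map_fst_apply_toReal, hpa, ← Finset.mul_sum, PMF.sum_toReal, mul_one]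
    rw [Finset.sum_const, Finset.card_univ, nsmul_eq_mul, ← hm, Real.negMulLog, Real.log_inv,
      Real.logb]
    field_simp
  -- On $S$ the mass of $y$ splits into $m$ equal parts, which adds $\log m$ times that mass to the
  -- entropy; off $S$ one index carries all of it and nothing is added.
  have h2 : ∀ y, ∑ k, Real.negMulLog (p (k, y)).toReal =
      Real.negMulLog (∑ k, (p (k, y)).toReal) +
        Real.log m * (m⁻¹ * ∑ k, (r k y).toReal * if y ∈ S then 1 else 0) := by
    intro y
    by_cases hy : y ∈ S
    · obtain ⟨k₀⟩ := ‹Nonempty ι›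
      have : ∀ k, (r k y) = r k₀ y := fun k => hin y hy k k₀
      simp only [hpa, this, Finset.sum_const, Finset.card_univ, nsmul_eq_mul, ← hm, hy, if_true,
        mul_one, mul_inv_cancel_left₀ hm0, inv_mul_cancel_left₀ hm0]
      rw [Real.negMulLog_mul]
      simp only [Real.negMulLog, Real.log_inv]
      field_simp
      ring
    · simp only [hy, if_false, mul_zero, Finset.sum_const_zero, add_zero]
      by_cases hb : ∃ a, r a y ≠ 0
      · obtain ⟨a, ha⟩ := hb
        have h0 : ∀ a', a' ≠ a → (p (a', y)).toReal = 0 := by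
          intro a' ha'
          by_contra hne
          refine ha' (hout y hy a' a ?_ ha)
          rintro h
          simp [hpa, h] at hne
        rw [Finset.sum_eq_single a, Finset.sum_eq_single a]
        all_goals simp +contextual [h0]
      · push Not at hb
        simp [hpa, hb]
  have h3 : shannonEntropy p = shannonEntropy (p.map Prod.snd) + (1 - c) * Real.logb 2 m := by
    rw [shannonEntropy_eq_sum, shannonEntropy_eq_sum, Fintype.sum_prod_type_right]
    simp only [PMF.map_snd_apply_toReal, h2, Finset.sum_add_distrib, ← Finset.mul_sum]
    rw [Finset.sum_comm]
    have h4 : ∀ k, ∑ y, (r k y).toReal * (if y ∈ S then 1 else 0) = 1 - c := by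
      intro k
      rw [eq_sub_iff_add_eq, ← hc k, PMF.expect, tsum_fintype, ← Finset.sum_add_distrib]
      refine (Finset.sum_congr rfl fun y _ => ?_).trans (r k).sum_toReal
      split_ifs <;> simp
    simp only [h4, Finset.sum_const, Finset.card_univ, nsmul_eq_mul, ← hm]
    rw [Real.logb]
    field_simp
  rw [mutualInfo, h1, h3]
  ring

/-! ### Existence of the codes -/

/-- The maximal length of the codes used with at most `M` files. -/
def maxCodeLength (N T M : ℕ) : ℕ :=
  ∑ s ∈ range (M + 1), ∑ i ∈ range s, (N * symbolCount N T s i + N * symbolCount N T s (i + 1))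

theorem le_maxCodeLength (N T : ℕ) {M s i : ℕ} (his : i < s) (hs : s ≤ M) :
    N * symbolCount N T s i + N * symbolCount N T s (i + 1) ≤ maxCodeLength N T M :=
  (single_le_sum (f := fun i => N * symbolCount N T s i + N * symbolCount N T s (i + 1))
    (fun _ _ => Nat.zero_le _) (mem_range.2 his)).trans
  (single_le_sum (f := fun s => ∑ i ∈ range s,
      (N * symbolCount N T s i + N * symbolCount N T s (i + 1)))
    (fun _ _ => Nat.zero_le _) (mem_range.2 (Nat.lt_succ_of_le hs)))

/-- A Vandermonde matrix with distinct nodes generates an MDS code. -/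
theorem exists_matrix_submatrix_det_ne_zero (R C F : Type*) [Fintype R] [Fintype C] [DecidableEq C]
    [Field F] [Finite F] (h : Fintype.card R ≤ Nat.card F) :
    ∃ A : Matrix R C F, ∀ f : C ↪ R, (A.submatrix f id).det ≠ 0 := by
  have := Fintype.ofFinite F
  rw [Nat.card_eq_fintype_card] at h
  obtain ⟨x⟩ := Function.Embedding.nonempty_of_card_le h
  let e := Fintype.equivFin C
  refine ⟨Matrix.of fun r c => x r ^ (e c : ℕ), fun f => ?_⟩
  have : (Matrix.of fun r c => x r ^ (e c : ℕ)).submatrix f id =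
      (Matrix.vandermonde fun i => x (f (e.symm i))).submatrix e e := by
    ext i j
    simp [Matrix.vandermonde]
  rw [this, Matrix.det_submatrix_equiv_self, Matrix.det_vandermonde_ne_zero_iff]
  exact x.injective.comp (f.injective.comp e.symm.injective)

theorem nonempty_mdsFamily (N T M : ℕ) (F : Type*) [Field F] [Finite F]
    (hF : maxCodeLength N T M ≤ Nat.card F) : Nonempty (MDSFamily N T M F) := by
  have : ∀ s i : ℕ, ∃ A : Matrix
      ((Fin N × Fin (symbolCount N T s i)) ⊕ (Fin N × Fin (symbolCount N T s (i + 1))))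
      (Fin N × Fin (symbolCount N T s i)) F, 1 ≤ i → i < s → s ≤ M →
        ∀ f : (Fin N × Fin (symbolCount N T s i)) ↪
          ((Fin N × Fin (symbolCount N T s i)) ⊕ (Fin N × Fin (symbolCount N T s (i + 1)))),
        (A.submatrix f id).det ≠ 0 := by
    intro s i
    by_cases h : i < s ∧ s ≤ M
    · obtain ⟨A, hA⟩ := exists_matrix_submatrix_det_ne_zero
        ((Fin N × Fin (symbolCount N T s i)) ⊕ (Fin N × Fin (symbolCount N T s (i + 1))))
        (Fin N × Fin (symbolCount N T s i)) F
        (by simpa using (le_maxCodeLength N T h.1 h.2).trans hF)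
      exact ⟨A, fun _ _ _ => hA⟩
    · exact ⟨0, fun _ h1 h2 => absurd ⟨h1, h2⟩ h⟩
  choose A hA using this
  exact ⟨⟨A, hA⟩⟩

/-! ### Linear systems with values in a module -/

/-- Apply $B^{-1}$. The unknowns are segments, hence vectors of $\mathcal A$ rather than scalars. -/
theorem eq_zero_of_sum_smul_eq_zero {m F A : Type*} [Fintype m] [DecidableEq m] [Field F]
    [AddCommGroup A] [Module F A] (B : Matrix m m F) (hB : B.det ≠ 0) (y : m → A)
    (h : ∀ i, ∑ j, B i j • y j = 0) : y = 0 := by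
  have hinv : B⁻¹ * B = 1 := Matrix.nonsing_inv_mul B (isUnit_iff_ne_zero.2 hB)
  funext i
  calc y i = ∑ j, (1 : Matrix m m F) i j • y j := by simp [Matrix.one_apply, ite_smul]
    _ = ∑ k, B⁻¹ i k • ∑ j, B k j • y j := by
        simp only [← hinv, Matrix.mul_apply, Finset.sum_smul, Finset.smul_sum, smul_smul]
        exact Finset.sum_comm
    _ = 0 := by simp [h]

/-- Linearly independent rows can be completed to an invertible matrix, in any given positions. -/
theorem exists_GL_rows {I m F : Type*} [Fintype m] [DecidableEq m] [Field F]
    (f : I → m) (hf : Function.Injective f) (v : I → m → F) (hv : LinearIndependent F v) :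
    ∃ B : Matrix.GeneralLinearGroup m F, ∀ i, B.1 (f i) = v i := by
  classical
  have := hv.finite
  have := Fintype.ofFinite I
  let b := Module.Basis.sumExtend hv
  have : Finite (I ⊕ Module.Basis.sumExtendIndex hv) := Module.Finite.finite_basis b
  have : Finite (Module.Basis.sumExtendIndex hv) := 
    Finite.of_injective (Sum.inr : _ → I ⊕ Module.Basis.sumExtendIndex hv) Sum.inr_injective
  have := Fintype.ofFinite (Module.Basis.sumExtendIndex hv)
  have hcard : Fintype.card (I ⊕ Module.Basis.sumExtendIndex hv) = Fintype.card m := by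
    rw [← Module.finrank_eq_card_basis b, Module.finrank_fintype_fun_eq_card]
  let e₀ := Equiv.ofInjective f hf
  let g := Equiv.Set.sumCompl (Set.range f)
  -- The vectors completing `v` to a basis are as many as the positions left free by `f`, so the
  -- basis can be numbered with `v i` at position `f i`.
  have hc : Fintype.card (Module.Basis.sumExtendIndex hv) = Fintype.card ↥(Set.range f)ᶜ := by
    have h1 := Fintype.card_congr g
    have h2 := Fintype.card_congr e₀
    rw [Fintype.card_sum] at hcard h1
    omega
  let e₁ := Fintype.equivOfCardEq hc
  let e : I ⊕ Module.Basis.sumExtendIndex hv ≃ m := (Equiv.sumCongr e₀ e₁).trans g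
  let b' := b.reindex e
  have hu : IsUnit (Matrix.of fun i => b' i) :=
    Matrix.linearIndependent_rows_iff_isUnit.1 b'.linearIndependent
  refine ⟨hu.unit, fun i => ?_⟩
  have he : e.symm (f i) = Sum.inl i := by
    rw [Equiv.symm_apply_eq]
    simp [e, e₀, g]
  have hb : b (Sum.inl i) = v i := by
    change (Module.Basis.sumExtend hv) (Sum.inl i) = v i
    simp only [Module.Basis.sumExtend, Module.Basis.reindex_apply, Module.Basis.coe_extend]
    rfl
  rw [← hb, ← he]
  exact b.reindex_apply e (f i)

/-! ### Decoding the Sun-Jafar scheme -/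

theorem segmentIdx_surjective {M N : ℕ} (K : Finset (Fin M)) (i : Fin (N ^ M)) :
    ∃ c r, segmentIdx N K c r = i := by
  have e : N ^ M = N ^ K.card * N ^ (M - K.card) := by
    rw [← pow_add, Nat.add_sub_cancel' (by simpa using card_le_univ K)]
  refine ⟨(finProdFinEquiv.symm (Fin.cast e i)).1, (finProdFinEquiv.symm (Fin.cast e i)).2, ?_⟩
  rw [segmentIdx, Prod.mk.eta, Equiv.apply_symm_apply]
  rfl

/-- The row `(V, p)` of the matrix of file `k`, applied to `x k`; zero if `k ∉ V`. -/
def rowValue {M N T : ℕ} (hTN : T ≤ N) {F A : Type*} [Field F] [AddCommGroup A] [Module F A]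
    (K : Finset (Fin M)) (S : Fin M → Matrix.GeneralLinearGroup (Fin (N ^ K.card)) F)
    (x : Fin M → Fin (N ^ K.card) → A) (V : Finset (Fin M)) (hV : V ⊆ K) (k : Fin M)
    (p : Fin N × Fin (symbolCount N T K.card V.card)) : A :=
  if hk : k ∈ V then ∑ d, (S k).1 (rowEquiv hTN (hV hk) ⟨⟨V, hV, hk⟩, p⟩) d • x k d else 0

section

variable {M N T : ℕ} (hTN : T ≤ N) {F A : Type*} [Field F] [AddCommGroup A] [Module F A]
  (G : MDSFamily N T M F) (K : Finset (Fin M)) (l : Fin M)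
  (S : Fin M → Matrix.GeneralLinearGroup (Fin (N ^ K.card)) F) (x : Fin M → Fin (N ^ K.card) → A)

/-- The matrix on the right does not depend on `k`, so summing over the files yields the code word
of the summed row values. Setting `rowValue` to zero for files outside the type lets this sum run
over all indices. -/
theorem sum_sunJafarQuery_smul_of_notMem (n : Fin N) (V : SumType K) (hl : l ∉ V.1)
    (j : Fin (symbolCount N T K.card V.1.card)) (k : Fin M) :
    ∑ d, sunJafarQuery hTN G K l S n V j k d • x k d =
      ∑ p, G.gen K.card V.1.card (Sum.inl (n, j)) p • rowValue hTN K S x V.1 V.2.1 k p := by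
  by_cases hk : k ∈ V.1
  · have hkl : k ≠ l := fun h => hl (h ▸ hk)
    simp only [sunJafarQuery, rowValue, hk, hkl, hl, dite_true, dite_false, if_false, sum_smul,
      smul_sum, mul_smul]
    exact sum_comm
  · simp [sunJafarQuery, rowValue, hk]

theorem sum_sunJafarQuery_smul_self (n : Fin N) (V : SumType K) (hl : l ∈ V.1)
    (j : Fin (symbolCount N T K.card V.1.card)) :
    ∑ d, sunJafarQuery hTN G K l S n V j l d • x l d =
      rowValue hTN K S x V.1 V.2.1 l (n, j) := by
  simp [sunJafarQuery, rowValue, hl]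

theorem sum_sunJafarQuery_smul_of_ne (n : Fin N) (V : SumType K) (hl : l ∈ V.1)
    (j : Fin (symbolCount N T K.card V.1.card)) (k : Fin M) (hkl : k ≠ l) :
    ∑ d, sunJafarQuery hTN G K l S n V j k d • x k d =
      ∑ p, G.gen K.card (V.1.erase l).card
          (Sum.inr (n, Fin.cast (by rw [card_erase_add_one hl]) j)) p •
        rowValue hTN K S x (V.1.erase l) ((erase_subset _ _).trans V.2.1) k p := by
  by_cases hk : k ∈ V.1
  · have hk' : k ∈ V.1.erase l := mem_erase.2 ⟨hkl, hk⟩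
    simp only [sunJafarQuery, rowValue, hk, hk', hkl, hl, dite_true, if_false, sum_smul,
      smul_sum, mul_smul]
    exact sum_comm
  · have hk' : k ∉ V.1.erase l := fun h => hk (mem_of_mem_erase h)
    simp [sunJafarQuery, rowValue, hk, hk']

/-- If all answers vanish, then the interference of every type `V ∌ l` vanishes. -/
theorem sum_rowValue_eq_zero (hl : l ∈ K)
    (h : ∀ n V j, ∑ k, ∑ d, sunJafarQuery hTN G K l S n V j k d • x k d = 0)
    (V : Finset (Fin M)) (hV : V ⊆ K) (hlV : l ∉ V)
    (p : Fin N × Fin (symbolCount N T K.card V.card)) :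
    ∑ k, rowValue hTN K S x V hV k p = 0 := by
  -- The empty type is never requested, but it arises as $V\setminus\{l\}$ for $V=\{l\}$.
  rcases V.eq_empty_or_nonempty with rfl | hne
  · simp [rowValue]
  have hcard : V.card < K.card := card_lt_card ⟨hV, fun h => hlV (h hl)⟩
  -- The rows `Sum.inl` number exactly the dimension of the code, so they form an invertible square
  -- matrix.
  have hdet := G.isMDS K.card V.card hne.card_pos hcard (by simpa using card_le_univ K)
    ⟨Sum.inl, Sum.inl_injective⟩
  refine congrFun (eq_zero_of_sum_smul_eq_zero _ hdet
    (fun p => ∑ k, rowValue hTN K S x V hV k p) fun i => ?_) p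
  rw [← h i.1 ⟨V, hV, hne⟩ i.2]
  simp only [sum_sunJafarQuery_smul_of_notMem hTN G K l S x i.1 ⟨V, hV, hne⟩ hlV i.2, smul_sum]
  exact sum_comm

/-- The interference mixed with the desired symbol of type $V$ continues the code word of type
$V\setminus\{l\}$, whose message is already known to vanish; only the desired symbol remains. -/
theorem rowValue_self_eq_zero (hl : l ∈ K)
    (h : ∀ n V j, ∑ k, ∑ d, sunJafarQuery hTN G K l S n V j k d • x k d = 0)
    (V : Finset (Fin M)) (hV : V ⊆ K) (hlV : l ∈ V)
    (p : Fin N × Fin (symbolCount N T K.card V.card)) : rowValue hTN K S x V hV l p = 0 := by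
  have h1 := h p.1 ⟨V, hV, l, hlV⟩ p.2
  rw [← add_sum_erase _ _ (mem_univ l), sum_sunJafarQuery_smul_self _ _ _ _ _ _ _ _ hlV] at h1
  have h2 : ∑ k ∈ univ.erase l, ∑ d, sunJafarQuery hTN G K l S p.1 ⟨V, hV, l, hlV⟩ p.2 k d • x k d
      = 0 := by
    rw [sum_congr rfl fun k hk => sum_sunJafarQuery_smul_of_ne hTN G K l S x p.1 ⟨V, hV, l, hlV⟩
      hlV p.2 k (ne_of_mem_erase hk), sum_comm]
    refine sum_eq_zero fun q _ => ?_
    rw [← smul_sum]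
    have h3 := sum_rowValue_eq_zero hTN G K l S x hl h (V.erase l) ((erase_subset _ _).trans hV)
      (notMem_erase _ _) q
    rw [← add_sum_erase _ _ (mem_univ l)] at h3
    have h4 : rowValue hTN K S x (V.erase l) ((erase_subset _ _).trans hV) l q = 0 := by
      simp [rowValue]
    rw [h4, zero_add] at h3
    rw [h3, smul_zero]
  rwa [h2, add_zero] at h1

/-- The desired file can be recovered from the answers. -/
theorem eq_zero_of_sunJafarQuery_smul_eq_zero (hl : l ∈ K)
    (h : ∀ n V j, ∑ k, ∑ d, sunJafarQuery hTN G K l S n V j k d • x k d = 0) : x l = 0 := by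
  have hdet : (S l).1.det ≠ 0 := ((Matrix.isUnit_iff_isUnit_det _).1 (S l).isUnit).ne_zero
  refine eq_zero_of_sum_smul_eq_zero (S l).1 hdet (x l) fun i => ?_
  obtain ⟨⟨⟨V, hV, hlV⟩, p⟩, rfl⟩ := (rowEquiv hTN hl).surjective i
  have := rowValue_self_eq_zero hTN G K l S x hl h V hV hlV p
  simpa [rowValue, hlV] using this

end

/-! ### Correctness of the weakly private scheme -/

theorem mem_support_wQueryLaw {M N T : ℕ} [NeZero N] (hTN : T ≤ N) {F : Type*} [Field F] [Finite F]
    (G : MDSFamily N T M F) (P : PMF (Fin M)) (k : Fin M) {q : Fin N → WQuery M N T F}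
    (hq : q ∈ (wQueryLaw hTN G P k).support) :
    (∃ s, q = fun n => if n = s then .clean k else .null) ∨
      ∃ (K : Finset (Fin M)) (_ : k ∈ K) (S : _),
        q = fun n => .lin K (sunJafarQuery hTN G K k S n) := by
  rw [wQueryLaw, PMF.mem_support_bind_iff] at hq
  obtain ⟨m, -, hq⟩ := hq
  split_ifs at hq with hm
  · rw [PMF.mem_support_map_iff] at hq
    obtain ⟨s, -, rfl⟩ := hq
    exact Or.inl ⟨s, rfl⟩
  · rw [PMF.mem_support_bind_iff] at hq
    obtain ⟨J, -, hq⟩ := hq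
    rw [PMF.mem_support_map_iff] at hq
    obtain ⟨S, -, rfl⟩ := hq
    exact Or.inr ⟨_, mem_insert_self _ _, S, rfl⟩

theorem tWSJ_answers_determine_file {M N T : ℕ} [NeZero N] (hTN : T ≤ N) {F : Type*} [Field F]
    [Finite F] {A : Type*} [AddCommGroup A] [Module F A] (G : MDSFamily N T M F) (P : PMF (Fin M))
    (k : Fin M) {q : Fin N → WQuery M N T F} (hq : q ∈ (wQueryLaw hTN G P k).support)
    {W W' : Fin M → Fin (N ^ M) → A} (h : ∀ n, wAnswer (q n) W = wAnswer (q n) W') :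
    W k = W' k := by
  obtain ⟨s, rfl⟩ | ⟨K, hk, S, rfl⟩ := mem_support_wQueryLaw hTN G P k hq
  · have := h s
    beta_reduce at this
    rw [if_pos rfl] at this
    exact this
  · funext i
    obtain ⟨c, r, rfl⟩ := segmentIdx_surjective K i
    -- For each fixed position `r` inside the super-segments, the differences of the two lists of
    -- files solve the same homogeneous system.
    have h0 := eq_zero_of_sunJafarQuery_smul_eq_zero hTN G K k S
      (fun k d => W k (segmentIdx N K d r) - W' k (segmentIdx N K d r)) hk fun n V j => by
        have := congrFun (h n) ⟨V, j, r⟩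
        simp only [smul_sub, sum_sub_distrib]
        exact sub_eq_zero.2 this
    exact sub_eq_zero.1 (congrFun h0 c)

theorem tWSJ_correct {M N T : ℕ} [NeZero N] (hTN : T ≤ N) {F : Type*} [Field F] [Finite F]
    (A : Type*) [AddCommGroup A] [Module F A] [Finite A] (G : MDSFamily N T M F)
    (P : PMF (Fin M)) : (tWSJ hTN A G P).Correct := by
  intro k
  refine condEntropy_eq_zero_of_support _ ?_
  have hsupp : ∀ x ∈ ((tWSJ hTN A G P).fileTranscriptLaw k).support,
      ∃ W, ∃ q ∈ (wQueryLaw hTN G P k).support,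
        x = (W k, ⟨q, fun n => wAnswer (q n) W⟩) := by
    intro x hx
    rw [IRScheme.fileTranscriptLaw, PMF.mem_support_bind_iff] at hx
    obtain ⟨W, -, hx⟩ := hx
    rw [PMF.mem_support_map_iff] at hx
    obtain ⟨q, hq, rfl⟩ := hx
    exact ⟨W, q, hq, rfl⟩
  intro x hx y hy hxy
  obtain ⟨W, q, hq, rfl⟩ := hsupp x hx
  obtain ⟨W', q', hq', rfl⟩ := hsupp y hy
  obtain ⟨rfl, h⟩ := Sigma.mk.inj_iff.1 hxy
  exact tWSJ_answers_determine_file hTN G P k hq fun n => congrFun (eq_of_heq h) n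

/-! ### Privacy of the Sun-Jafar scheme against `T` colluding servers -/

theorem uniformLaw_map_equiv {α : Type*} [Finite α] [Nonempty α] (e : α ≃ α) :
    (uniformLaw α).map e = uniformLaw α := by
  classical
  ext b
  rw [PMF.map_apply, tsum_eq_single (e.symm b)]
  · simp [uniformLaw]
  · intro a ha
    rw [if_neg]
    rintro rfl
    simp at ha

/-- Factoring out $(N-T)^{i-1}T^{s-i}$ leaves $T+(N-T)=N$. The left side counts the symbols of one
code word seen by $T$ servers, the right side is the dimension of the code. -/
theorem mul_symbolCount_add {N T s i : ℕ} (hTN : T ≤ N) (hi : 1 ≤ i) (his : i < s) :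
    T * symbolCount N T s i + T * symbolCount N T s (i + 1) = N * symbolCount N T s i := by
  obtain ⟨j, rfl⟩ := Nat.exists_eq_add_of_le' hi
  obtain ⟨a, rfl⟩ := Nat.exists_eq_add_of_le hTN
  obtain ⟨b, rfl⟩ := Nat.exists_eq_add_of_lt his
  have h1 : j + 1 + b + 1 - (j + 1) = b + 1 := by omega
  have h2 : j + 1 + b + 1 - (j + 1 + 1) = b := by omega
  simp only [symbolCount, h1, h2, Nat.add_sub_cancel, Nat.add_sub_cancel_left]
  ring

/-- Labels of the code symbols that the servers in `𝒯` receive from one code word. -/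
abbrev CodeIdx {N : ℕ} (T : ℕ) (𝒯 : Finset (Fin N)) (s i : ℕ) : Type :=
  (𝒯 × Fin (symbolCount N T s i)) ⊕ (𝒯 × Fin (symbolCount N T s (i + 1)))

/-- The position of such a code symbol in the code word. -/
def CodeIdx.row {N T : ℕ} {𝒯 : Finset (Fin N)} {s i : ℕ} :
    CodeIdx T 𝒯 s i →
      (Fin N × Fin (symbolCount N T s i)) ⊕ (Fin N × Fin (symbolCount N T s (i + 1))) :=
  Sum.map (Prod.map Subtype.val id) (Prod.map Subtype.val id)

theorem CodeIdx.row_injective {N T : ℕ} {𝒯 : Finset (Fin N)} {s i : ℕ} :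
    Function.Injective (CodeIdx.row (T := T) (𝒯 := 𝒯) (s := s) (i := i)) :=
  Sum.map_injective.2 ⟨Subtype.val_injective.prodMap Function.injective_id,
    Subtype.val_injective.prodMap Function.injective_id⟩

/-- Any `T` servers see linearly independent symbols of a code word. -/
theorem MDSFamily.linearIndependent_gen {N T M : ℕ} (hTN : T ≤ N) {F : Type*} [Field F]
    (G : MDSFamily N T M F) {𝒯 : Finset (Fin N)} (h𝒯 : 𝒯.card = T) {s i : ℕ} (hi : 1 ≤ i)
    (his : i < s) (hs : s ≤ M) :
    LinearIndependent F fun x : CodeIdx T 𝒯 s i => G.gen s i x.row := by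
  have hcard : Fintype.card (Fin N × Fin (symbolCount N T s i)) =
      Fintype.card (CodeIdx T 𝒯 s i) := by
    simp [h𝒯, mul_symbolCount_add hTN hi his]
  let ψ := Fintype.equivOfCardEq hcard
  have hdet := G.isMDS s i hi his hs
    (ψ.toEmbedding.trans ⟨CodeIdx.row, CodeIdx.row_injective⟩)
  have hli := Matrix.linearIndependent_rows_iff_isUnit.2
    ((Matrix.isUnit_iff_isUnit_det _).2 (isUnit_iff_ne_zero.2 hdet))
  have := hli.comp ψ.symm ψ.symm.injective
  convert this using 1
  funext x
  funext p
  change _ = G.gen s i (CodeIdx.row (ψ (ψ.symm x))) p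
  rw [Equiv.apply_symm_apply]

section

variable {M N T : ℕ} (hTN : T ≤ N) {F : Type*} [Field F]

/-- Sets of files of `K` which contain `k` but not `l`: the types of the code words of file `k`. -/
abbrev CodeType {M : ℕ} (K : Finset (Fin M)) (k l : Fin M) : Type :=
  {U : Finset (Fin M) // (U ⊆ K ∧ k ∈ U) ∧ l ∉ U}

/-- Coefficient vectors of the code words of file `k`, extended by zero to all rows. -/
def codeCoeff {K : Finset (Fin M)} {k : Fin M} (l : Fin M) (hk : k ∈ K) :
    (∀ U : CodeType K k l, Fin N × Fin (symbolCount N T K.card U.1.card) → F) →ₗ[F]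
      (Fin (N ^ K.card) → F) where
  toFun a c := if h : l ∉ ((rowEquiv hTN hk).symm c).1.1 then
    a ⟨((rowEquiv hTN hk).symm c).1.1, ((rowEquiv hTN hk).symm c).1.2, h⟩
      ((rowEquiv hTN hk).symm c).2 else 0
  map_add' a b := by
    funext c
    by_cases h : l ∈ ((rowEquiv hTN hk).symm c).1.1 <;> simp [h]
  map_smul' r a := by
    funext c
    by_cases h : l ∈ ((rowEquiv hTN hk).symm c).1.1 <;> simp [h]

theorem codeCoeff_rowEquiv {K : Finset (Fin M)} {k : Fin M} (l : Fin M) (hk : k ∈ K)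
    (a : ∀ U : CodeType K k l, Fin N × Fin (symbolCount N T K.card U.1.card) → F)
    (x : RowIdx N T K k) : codeCoeff hTN l hk a (rowEquiv hTN hk x) =
      if h : l ∉ x.1.1 then a ⟨x.1.1, x.1.2, h⟩ x.2 else 0 := by
  obtain ⟨y, rfl⟩ := (rowEquiv hTN hk).symm.surjective x
  rw [Equiv.apply_symm_apply]
  rfl

theorem codeCoeff_injective {K : Finset (Fin M)} {k : Fin M} (l : Fin M) (hk : k ∈ K) :
    Function.Injective (codeCoeff (T := T) (F := F) hTN l hk) := by
  intro a b hab
  funext U p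
  have := congrFun hab (rowEquiv hTN hk ⟨⟨U.1, U.2.1⟩, p⟩)
  simpa only [codeCoeff_rowEquiv, U.2.2, not_false_eq_true, dite_true] using this

/-- The combination of rows of `S` prescribed by one symbol of the code word of type `U`. -/
theorem sum_codeCoeff_single_mul {K : Finset (Fin M)} {k : Fin M} (l : Fin M) (hk : k ∈ K)
    (U : CodeType K k l) (g : Fin N × Fin (symbolCount N T K.card U.1.card) → F)
    (f : Fin (N ^ K.card) → F) :
    ∑ c, codeCoeff hTN l hk (Pi.single U g) c * f c =
      ∑ p, g p * f (rowEquiv hTN hk ⟨⟨U.1, U.2.1⟩, p⟩) := by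
  rw [← (rowEquiv hTN hk).sum_comp, Fintype.sum_sigma, sum_eq_single ⟨U.1, U.2.1⟩]
  · refine sum_congr rfl fun p _ => ?_
    rw [codeCoeff_rowEquiv, dif_pos U.2.2]
    simp
  · intro V _ hV
    refine sum_eq_zero fun p _ => ?_
    rw [codeCoeff_rowEquiv]
    split_ifs with h
    · rw [zero_mul]
    · rw [Pi.single_eq_of_ne, Pi.zero_apply, zero_mul]
      rintro rfl
      exact hV rfl
  · simp

/-- Labels of the symbols of file `k` that the servers in `𝒯` are asked for. -/
abbrev SeenIdx (T : ℕ) (𝒯 : Finset (Fin N)) (K : Finset (Fin M)) (k : Fin M) : Type :=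
  Σ V : {V : Finset (Fin M) // V ⊆ K ∧ k ∈ V}, 𝒯 × Fin (symbolCount N T K.card V.1.card)

/-- The code word and the position in which a symbol of an undesired file occurs. -/
def SeenIdx.code {𝒯 : Finset (Fin N)} {K : Finset (Fin M)} {k l : Fin M} (hkl : k ≠ l)
    (x : SeenIdx T 𝒯 K k) : Σ U : CodeType K k l, CodeIdx T 𝒯 K.card U.1.card :=
  if hl : l ∈ x.1.1 then
    ⟨⟨x.1.1.erase l, ⟨(erase_subset _ _).trans x.1.2.1, mem_erase.2 ⟨hkl, x.1.2.2⟩⟩,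
      notMem_erase _ _⟩, Sum.inr (x.2.1, Fin.cast (by rw [card_erase_add_one hl]) x.2.2)⟩
  else ⟨⟨x.1.1, x.1.2, hl⟩, Sum.inl x.2⟩

theorem SeenIdx.code_of_mem {𝒯 : Finset (Fin N)} {K : Finset (Fin M)} {k l : Fin M} (hkl : k ≠ l)
    {x : SeenIdx T 𝒯 K k} (hl : l ∈ x.1.1) : x.code hkl =
      ⟨⟨x.1.1.erase l, ⟨(erase_subset _ _).trans x.1.2.1, mem_erase.2 ⟨hkl, x.1.2.2⟩⟩,
        notMem_erase _ _⟩, Sum.inr (x.2.1, Fin.cast (by rw [card_erase_add_one hl]) x.2.2)⟩ :=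
  dif_pos hl

theorem SeenIdx.code_of_notMem {𝒯 : Finset (Fin N)} {K : Finset (Fin M)} {k l : Fin M}
    (hkl : k ≠ l) {x : SeenIdx T 𝒯 K k} (hl : l ∉ x.1.1) :
    x.code hkl = ⟨⟨x.1.1, x.1.2, hl⟩, Sum.inl x.2⟩ :=
  dif_neg hl

/-- The row of coefficients of a symbol of a code word of file `k`. -/
def codeRow (G : MDSFamily N T M F) {𝒯 : Finset (Fin N)} {K : Finset (Fin M)} {k : Fin M}
    (l : Fin M) (hk : k ∈ K) (y : Σ U : CodeType K k l, CodeIdx T 𝒯 K.card U.1.card) :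
    Fin (N ^ K.card) → F :=
  codeCoeff hTN l hk (Pi.single y.1 (G.gen K.card y.1.1.card y.2.row))

/-- The part of the code word (`inl` or `inr`) tells whether $l\in V$, so $V$ can be recovered from
the type of the code word. -/
theorem SeenIdx.code_injective {𝒯 : Finset (Fin N)} {K : Finset (Fin M)} {k l : Fin M}
    (hkl : k ≠ l) :
    Function.Injective (SeenIdx.code (T := T) (𝒯 := 𝒯) (K := K) hkl) := by
  rintro ⟨⟨V, hV⟩, n, j⟩ ⟨⟨V', hV'⟩, n', j'⟩ h
  by_cases hl : l ∈ V <;> by_cases hl' : l ∈ V'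
  · rw [SeenIdx.code_of_mem hkl hl, SeenIdx.code_of_mem hkl hl'] at h
    have hU : V.erase l = V'.erase l := congrArg (fun y => y.1.1) h
    have hVV : V = V' := by rw [← insert_erase hl, hU, insert_erase hl']
    subst hVV
    simpa using h
  · rw [SeenIdx.code_of_mem hkl hl, SeenIdx.code_of_notMem hkl hl'] at h
    exact absurd (congrArg (fun y => y.2.isRight) h) (by simp)
  · rw [SeenIdx.code_of_notMem hkl hl, SeenIdx.code_of_mem hkl hl'] at h
    exact absurd (congrArg (fun y => y.2.isRight) h) (by simp)
  · rw [SeenIdx.code_of_notMem hkl hl, SeenIdx.code_of_notMem hkl hl'] at h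
    have hVV : V = V' := congrArg (fun y => y.1.1) h
    subst hVV
    simpa using h

/-- The symbols of an undesired file seen by `T` servers are linearly independent. -/
theorem linearIndependent_seen (G : MDSFamily N T M F) {𝒯 : Finset (Fin N)} (h𝒯 : 𝒯.card = T)
    {K : Finset (Fin M)} {k l : Fin M} (hk : k ∈ K) (hl : l ∈ K) (hkl : k ≠ l) :
    LinearIndependent F fun x : SeenIdx T 𝒯 K k => codeRow hTN G l hk (x.code hkl) := by
  -- Different code words use disjoint blocks of rows, so independence within each code word is
  -- enough.
  have h1 := Pi.linearIndependent_single (R := F)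
    (fun (U : CodeType K k l) (x : CodeIdx T 𝒯 K.card U.1.card) =>
      G.gen K.card U.1.card x.row) fun U =>
        G.linearIndependent_gen hTN h𝒯 (card_pos.2 ⟨k, U.2.1.2⟩)
          (card_lt_card ⟨U.2.1.1, fun h => U.2.2 (h hl)⟩) (by simpa using card_le_univ K)
  have h2 := h1.map' (codeCoeff hTN l hk)
    (LinearMap.ker_eq_bot.2 (codeCoeff_injective hTN l hk))
  exact h2.comp _ (SeenIdx.code_injective hkl)

/-- The query which asks for the rows of the matrices `S`, irrespective of the desired file. -/
def rowQuery (K : Finset (Fin M)) (S : Fin M → Matrix.GeneralLinearGroup (Fin (N ^ K.card)) F)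
    (n : Fin N) : LinQuery N T F K := fun V j k c =>
  if hk : k ∈ V.1 then (S k).1 (rowEquiv hTN (V.2.1 hk) ⟨⟨V.1, V.2.1, hk⟩, n, j⟩) c else 0

/-- The coefficient vectors of the seen symbols are independent, so they can be the rows of an
invertible `B` at the seen positions; its other rows are irrelevant. It matters that `B` is chosen
before `S`. For the desired file, and for files outside `K`, `B = 1` works. -/
theorem exists_GL_mul_row_eq (G : MDSFamily N T M F) {𝒯 : Finset (Fin N)} (h𝒯 : 𝒯.card = T)
    {K : Finset (Fin M)} {k l : Fin M} (hl : l ∈ K) :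
    ∃ B : Matrix.GeneralLinearGroup (Fin (N ^ K.card)) F,
      ∀ S : Fin M → Matrix.GeneralLinearGroup (Fin (N ^ K.card)) F, ∀ n ∈ 𝒯, ∀ V j c,
        sunJafarQuery hTN G K l S n V j k c =
          if hk : k ∈ V.1 then
            (B * S k).1 (rowEquiv hTN (V.2.1 hk) ⟨⟨V.1, V.2.1, hk⟩, n, j⟩) c else 0 := by
  by_cases hkl : k = l
  · refine ⟨1, fun S n hn V j c => ?_⟩
    simp [sunJafarQuery, hkl]
  by_cases hk : k ∈ K
  · obtain ⟨B, hB⟩ := exists_GL_rows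
      (fun x : SeenIdx T 𝒯 K k => rowEquiv hTN hk ⟨x.1, x.2.1.1, x.2.2⟩)
      (by
        rintro ⟨V, n, j⟩ ⟨V', n', j'⟩ h
        obtain ⟨rfl, h⟩ := Sigma.mk.inj_iff.1 ((rowEquiv hTN hk).injective h)
        simp only [heq_eq_eq, Prod.mk.injEq] at h
        obtain ⟨h1, rfl⟩ := h
        obtain rfl := Subtype.ext h1
        rfl) _ (linearIndependent_seen hTN G h𝒯 hk hl hkl)
    refine ⟨B, fun S n hn V j c => ?_⟩
    by_cases hkV : k ∈ V.1
    · have hrow := hB ⟨⟨V.1, V.2.1, hkV⟩, ⟨n, hn⟩, j⟩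
      simp only at hrow
      rw [dif_pos hkV, Units.val_mul, Matrix.mul_apply, hrow]
      by_cases hlV : l ∈ V.1
      · have hkV' : k ∈ V.1.erase l := mem_erase.2 ⟨hkl, hkV⟩
        rw [SeenIdx.code_of_mem hkl hlV, codeRow, sum_codeCoeff_single_mul]
        simp only [sunJafarQuery, hkV, hkl, hlV, hkV', dite_true, if_false]
        rfl
      · rw [SeenIdx.code_of_notMem hkl hlV, codeRow, sum_codeCoeff_single_mul]
        simp only [sunJafarQuery, hkV, hkl, hlV, dite_true, dite_false, if_false]
        rfl
    · simp [sunJafarQuery, hkV]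
  · refine ⟨1, fun S n hn V j c => ?_⟩
    have : k ∉ V.1 := fun h => hk (V.2.1 h)
    simp [sunJafarQuery, this]

/-- Seen by `T` servers, the Sun-Jafar queries are distributed as if no file were distinguished. -/
theorem map_sunJafarQuery_restrict [Finite F] (G : MDSFamily N T M F) {𝒯 : Finset (Fin N)}
    (h𝒯 : 𝒯.card = T) {K : Finset (Fin M)} {l : Fin M} (hl : l ∈ K) :
    (uniformLaw (Fin M → Matrix.GeneralLinearGroup (Fin (N ^ K.card)) F)).map
        (fun S (t : 𝒯) => sunJafarQuery hTN G K l S t) =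
      (uniformLaw (Fin M → Matrix.GeneralLinearGroup (Fin (N ^ K.card)) F)).map
        (fun S (t : 𝒯) => rowQuery hTN K S t) := by
  choose B hB using fun k => exists_GL_mul_row_eq (k := k) hTN G h𝒯 hl
  -- Left multiplication by the fixed tuple `B` permutes the tuples of invertible matrices.
  have : (fun S (t : 𝒯) => sunJafarQuery hTN G K l S t) =
      (fun S (t : 𝒯) => rowQuery hTN K S t) ∘ Equiv.mulLeft B := by
    funext S t V j k c
    exact hB k S t t.2 V j c
  rw [this, ← PMF.map_comp, uniformLaw_map_equiv]

end

/-! ### Download count -/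

/-- Induction on `K`: when a file is added, the old types are requested $T$ times as often, and the
types containing the new file contribute $N^{|K|}$ by the binomial theorem. -/
theorem sum_powerset_symbolCount {M N T : ℕ} [NeZero N] (hTN : T ≤ N) (K : Finset (Fin M)) :
    (N : ℝ) * ∑ V ∈ K.powerset, (if V.Nonempty then (symbolCount N T K.card V.card : ℝ) else 0) =
      (N : ℝ) ^ K.card * ∑ i ∈ range K.card, ((T : ℝ) / N) ^ i := by
  have hN : (N : ℝ) ≠ 0 := NeZero.ne _
  induction K using Finset.induction_on with
  | empty => simp
  | insert x K hx ih =>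
    rw [sum_powerset_insert hx, card_insert_of_notMem hx]
    have hA : ∑ V ∈ K.powerset,
        (if V.Nonempty then (symbolCount N T (K.card + 1) V.card : ℝ) else 0) =
        T * ∑ V ∈ K.powerset, if V.Nonempty then (symbolCount N T K.card V.card : ℝ) else 0 := by
      rw [mul_sum]
      refine sum_congr rfl fun V hV => ?_
      split_ifs
      · have e : K.card + 1 - V.card = K.card - V.card + 1 := by
          have := card_le_card (mem_powerset.1 hV)
          omega
        simp only [symbolCount, e, pow_succ]
        push_cast
        ring
      · rw [mul_zero]
    have hB : ∑ V ∈ K.powerset, (if (insert x V).Nonempty then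
        (symbolCount N T (K.card + 1) (insert x V).card : ℝ) else 0) = (N : ℝ) ^ K.card := by
      have h := Finset.sum_pow_mul_eq_add_pow (N - T) T K
      rw [Nat.sub_add_cancel hTN] at h
      rw [← Nat.cast_pow, ← h, Nat.cast_sum]
      refine sum_congr rfl fun V hV => ?_
      have hxV : x ∉ V := fun h => hx (mem_powerset.1 hV h)
      have e : K.card + 1 - (V.card + 1) = K.card - V.card := by omega
      simp [symbolCount, card_insert_of_notMem hxV, e]
    rw [hA, hB, sum_range_succ', mul_add, mul_left_comm, ih]
    simp only [pow_succ, ← sum_mul]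
    field_simp

theorem card_wAnsIdx_lin {M N T : ℕ} [NeZero N] (hTN : T ≤ N) {F : Type*}
    (K : Finset (Fin M)) (c : LinQuery N T F K) :
    (N : ℝ) * Nat.card (WAnsIdx (WQuery.lin K c)) =
      (N : ℝ) ^ M * ∑ i ∈ range K.card, ((T : ℝ) / N) ^ i := by
  have h1 : Nat.card (WAnsIdx (WQuery.lin K c)) =
      ∑ V : SumType K, symbolCount N T K.card V.1.card * N ^ (M - K.card) := by
    simp [WAnsIdx]
  have h2 : ∑ V : SumType K, (symbolCount N T K.card V.1.card : ℝ) =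
      ∑ V ∈ K.powerset, if V.Nonempty then (symbolCount N T K.card V.card : ℝ) else 0 := by
    rw [← sum_filter]
    exact (sum_subtype _ (p := fun V => V ⊆ K ∧ V.Nonempty) (by simp)
      fun V => (symbolCount N T K.card V.card : ℝ)).symm
  rw [h1]
  push_cast
  rw [← sum_mul, h2, ← mul_assoc, sum_powerset_symbolCount hTN, mul_right_comm, ← pow_add,
    Nat.add_sub_cancel' (by simpa using card_le_univ K)]

/-! ### The mixture of clean downloads and Sun-Jafar queries -/

/-- The law of a coin which shows `true` with probability `p`. -/
def coinLaw (p : ℝ) (h0 : 0 ≤ p) (h1 : p ≤ 1) : PMF Bool :=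
  PMF.ofFintype (fun b => ENNReal.ofReal (bif b then p else 1 - p)) (by
    rw [Fintype.sum_bool, cond_true, cond_false, ← ENNReal.ofReal_add h0 (sub_nonneg.2 h1)]
    simp)

theorem expect_coinLaw {p : ℝ} (h0 : 0 ≤ p) (h1 : p ≤ 1) (f : Bool → ℝ) :
    (coinLaw p h0 h1).expect f = p * f true + (1 - p) * f false := by
  rw [PMF.expect, tsum_fintype, Fintype.sum_bool]
  simp [coinLaw, h0, h1]

theorem expect_uniformLaw {α : Type*} [Fintype α] [Nonempty α] (f : α → ℝ) :
    (uniformLaw α).expect f = (Fintype.card α : ℝ)⁻¹ * ∑ a, f a := by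
  simp only [PMF.expect, tsum_fintype, uniformLaw_apply_toReal, mul_sum]

theorem PMF.bind_eq_of_support {α β : Type*} (p : PMF α) {g : α → PMF β} {μ : PMF β}
    (h : ∀ a ∈ p.support, g a = μ) : p.bind g = μ := by
  rw [← PMF.bind_const p μ]
  ext b
  simp only [PMF.bind_apply]
  refine tsum_congr fun a => ?_
  by_cases ha : p a = 0
  · simp [ha]
  · rw [h a ((p.mem_support_iff a).2 ha)]

section

variable {M N T : ℕ} (hTN : T ≤ N) {F : Type*} [Field F] [Finite F]

/-- The law of `M'` which is `0` with probability `p` and `M - 1` otherwise. -/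
def extremeLaw (M : ℕ) [NeZero M] (p : ℝ) (h0 : 0 ≤ p) (h1 : p ≤ 1) : PMF (Fin M) :=
  (coinLaw p h0 h1).map fun b => bif b then 0 else Fin.rev 0

/-- The law of the queries for a clean download of file `k`. -/
def cleanLaw (N T : ℕ) [NeZero N] (F : Type*) (k : Fin M) : PMF (Fin N → WQuery M N T F) :=
  (uniformLaw (Fin N)).map fun s n => if n = s then .clean k else .null

/-- The law of the Sun-Jafar queries on the set `K` of files, with desired file `k`. -/
def sunJafarLaw (G : MDSFamily N T M F) (K : Finset (Fin M)) (k : Fin M) :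
    PMF (Fin N → WQuery M N T F) :=
  (uniformLaw (Fin M → Matrix.GeneralLinearGroup (Fin (N ^ K.card)) F)).map
    fun S n => .lin K (sunJafarQuery hTN G K k S n)

/-- When $M'=M-1$ the set $J$ must contain all the other files, so its choice involves no
randomness. -/
theorem wQueryLaw_extremeLaw [NeZero M] [NeZero N] (hM : 2 ≤ M) (G : MDSFamily N T M F)
    {p : ℝ} (h0 : 0 ≤ p) (h1 : p ≤ 1) (k : Fin M) :
    wQueryLaw hTN G (extremeLaw M p h0 h1) k =
      (coinLaw p h0 h1).bind fun b => bif b then cleanLaw N T F k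
        else sunJafarLaw hTN G univ k := by
  rw [wQueryLaw, extremeLaw, PMF.bind_map]
  congr 1
  funext b
  cases b
  · have hlast : ((Fin.rev 0 : Fin M) : ℕ) = M - 1 := by simp [Fin.val_rev]
    have hne : ¬ ((Fin.rev 0 : Fin M) : ℕ) = 0 := by omega
    simp only [Function.comp_apply, cond_false]
    rw [if_neg hne]
    refine PMF.bind_eq_of_support _ fun J hJ => ?_
    rw [PMF.mem_support_uniformOfFinset_iff, mem_powersetCard, hlast] at hJ
    have hJ' : insert k J = univ := by
      rw [eq_of_subset_of_card_le hJ.1 (by simp [hJ.2]), insert_erase (mem_univ k)]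
    exact congrArg (fun K => sunJafarLaw hTN G K k) hJ'
  · simp only [Function.comp_apply, cond_true]
    rw [if_pos (by simp)]
    rfl

/-! ### Leakage -/

theorem map_sunJafarLaw_restrict (G : MDSFamily N T M F) {𝒯 : Finset (Fin N)} (h𝒯 : 𝒯.card = T)
    {K : Finset (Fin M)} {k k' : Fin M} (hk : k ∈ K) (hk' : k' ∈ K) :
    (sunJafarLaw hTN G K k).map (fun q (t : 𝒯) => q t) =
      (sunJafarLaw hTN G K k').map (fun q (t : 𝒯) => q t) := by
  have h : ∀ l ∈ K, (sunJafarLaw hTN G K l).map (fun q (t : 𝒯) => q t) =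
      ((uniformLaw (Fin M → Matrix.GeneralLinearGroup (Fin (N ^ K.card)) F)).map
        (fun S (t : 𝒯) => rowQuery hTN K S t)).map fun c t => .lin K (c t) := by
    intro l hl
    rw [← map_sunJafarQuery_restrict hTN G h𝒯 hl, sunJafarLaw, PMF.map_comp, PMF.map_comp]
    rfl
  rw [h k hk, h k' hk']

theorem leakage_tWSJ [NeZero M] [NeZero N] (hM : 2 ≤ M) (A : Type*) [AddCommGroup A] [Module F A]
    (G : MDSFamily N T M F) {p : ℝ} (h0 : 0 ≤ p) (h1 : p ≤ 1) {𝒯 : Finset (Fin N)}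
    (h𝒯 : 𝒯.card = T) :
    (tWSJ hTN A G (extremeLaw M p h0 h1)).leakage 𝒯 = p * (T / N) * Real.logb 2 M := by
  classical
  let r : Fin M → PMF (𝒯 → WQuery M N T F) := fun k =>
    (wQueryLaw hTN G (extremeLaw M p h0 h1) k).map fun q t => q t
  have hr : ∀ k, r k = (coinLaw p h0 h1).bind fun b =>
      bif b then (uniformLaw (Fin N)).map fun s (t : 𝒯) =>
        if (t : Fin N) = s then WQuery.clean k else WQuery.null
      else (sunJafarLaw hTN G univ k).map fun q (t : 𝒯) => q t := by
    intro k
    simp only [r, wQueryLaw_extremeLaw hTN hM G h0 h1, PMF.map_bind]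
    congr 1
    funext b
    cases b
    · rfl
    · simp only [cond_true, cleanLaw, PMF.map_comp]
      rfl
  have hlin : ∀ k, ∀ y ∈ ((sunJafarLaw hTN G univ k).map fun q (t : 𝒯) => q t).support,
      ∀ t k', y t ≠ .clean k' := by
    intro k y hy t k'
    rw [sunJafarLaw, PMF.map_comp, PMF.mem_support_map_iff] at hy
    obtain ⟨S, -, rfl⟩ := hy
    intro h
    change WQuery.lin univ _ = WQuery.clean k' at h
    cases h
  -- The observations without a clean query are those that reveal nothing.
  let S : Set (𝒯 → WQuery M N T F) := {y | ∀ t k, y t ≠ .clean k}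
  have main := mutualInfo_of_reveal r S (c := p * (T / N)) ?_ ?_ ?_
  · rw [Fintype.card_fin] at main
    rw [← main, IRScheme.leakage, IRScheme.indexQueryLaw, PMF.map_bind]
    simp only [PMF.map_comp, r]
    rfl
  · intro y hy k k'
    rw [hr, hr, PMF.bind_apply, PMF.bind_apply]
    refine tsum_congr fun b => ?_
    congr 1
    cases b
    · simp only [cond_false]
      rw [map_sunJafarLaw_restrict hTN G h𝒯 (mem_univ k) (mem_univ k')]
    · simp only [cond_true, PMF.map_apply]
      refine tsum_congr fun s => ?_
      -- Since `y` contains no clean query, the server `s` lies outside `𝒯`, and all of `𝒯` sees `φ`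
      -- whichever file is desired.
      have himp : ∀ k k', (y = fun t : 𝒯 => if (t : Fin N) = s then WQuery.clean k else .null) →
          y = fun t : 𝒯 => if (t : Fin N) = s then WQuery.clean k' else .null := by
        intro k k' h
        have hs : ∀ t : 𝒯, (t : Fin N) ≠ s := fun t ht => hy t k (by rw [h]; exact if_pos ht)
        rw [h]
        funext t
        rw [if_neg (hs t), if_neg (hs t)]
      congr 1
      exact propext ⟨himp k k', himp k' k⟩
  · have hdet : ∀ y t k₀, y t = WQuery.clean k₀ → ∀ k, r k y ≠ 0 → k = k₀ := by
      intro y t k₀ hy k hk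
      rw [← PMF.mem_support_iff, hr, PMF.mem_support_bind_iff] at hk
      obtain ⟨b, -, hk⟩ := hk
      cases b
      · exact absurd hy (hlin k y hk t k₀)
      · rw [cond_true, PMF.mem_support_map_iff] at hk
        obtain ⟨s, -, rfl⟩ := hk
        beta_reduce at hy
        split_ifs at hy
        exact WQuery.clean.inj hy
    intro y hy k k' hk hk'
    simp only [S, Set.mem_ofPred_eq, not_forall, not_not] at hy
    obtain ⟨t, k₀, ht⟩ := hy
    rw [hdet y t k₀ ht k hk, hdet y t k₀ ht k' hk']
  · intro k
    rw [hr, PMF.expect_bind, expect_coinLaw, cond_true, cond_false, PMF.expect_map,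
      PMF.expect_const_of_support _ (c := 0) fun y hy => if_pos (show y ∈ S from hlin k y hy),
      expect_uniformLaw]
    -- The index is revealed exactly when the uniform server `s` lies in `𝒯`, which has probability
    -- $T/N$.
    have : ∀ s : Fin N, (if (fun t : 𝒯 => if (t : Fin N) = s then WQuery.clean k else .null) ∈ S
        then (0 : ℝ) else 1) = if s ∈ 𝒯 then 1 else 0 := by
      intro s
      by_cases hs : s ∈ 𝒯
      · rw [if_pos hs, if_neg]
        exact fun h => h ⟨s, hs⟩ k (if_pos rfl)
      · rw [if_neg hs, if_pos]
        intro t k' h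
        have hts : (t : Fin N) ≠ s := fun h => hs (h ▸ t.2)
        beta_reduce at h
        rw [if_neg hts] at h
        cases h
    simp only [this, sum_ite_mem, univ_inter, sum_const, h𝒯, Fintype.card_fin, nsmul_eq_mul]
    ring

theorem milLeakage_tWSJ [NeZero M] [NeZero N] (hM : 2 ≤ M) (A : Type*) [AddCommGroup A] [Module F A]
    (G : MDSFamily N T M F) {p : ℝ} (h0 : 0 ≤ p) (h1 : p ≤ 1) :
    (tWSJ hTN A G (extremeLaw M p h0 h1)).milLeakage T = p * (T / N) * Real.logb 2 M := by
  have hc : (N.choose T : ℝ) ≠ 0 := by exact_mod_cast (Nat.choose_pos hTN).ne'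
  rw [IRScheme.milLeakage, sum_congr rfl fun 𝒯 h𝒯 =>
    leakage_tWSJ hTN hM A G h0 h1 (mem_powersetCard.1 h𝒯).2, sum_const, card_powersetCard,
    card_univ, Fintype.card_fin, nsmul_eq_mul]
  field_simp

/-! ### Rate -/

theorem downloadBits_tWSJ_lin [NeZero N] {A : Type*} [AddCommGroup A] [Module F A]
    (G : MDSFamily N T M F) (P : PMF (Fin M)) (K : Finset (Fin M)) (c : Fin N → LinQuery N T F K) :
    (tWSJ hTN A G P).downloadBits (fun n => .lin K (c n)) =
      (N : ℝ) ^ M * (∑ i ∈ range K.card, ((T : ℝ) / N) ^ i) * Real.logb 2 (Nat.card A) := by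
  have hN : (N : ℝ) ≠ 0 := NeZero.ne _
  have h : ∀ n, (Nat.card (WAnsIdx (WQuery.lin K (c n))) : ℝ) =
      (N : ℝ) ^ M * (∑ i ∈ range K.card, ((T : ℝ) / N) ^ i) / N := by
    intro n
    rw [eq_div_iff hN, mul_comm, card_wAnsIdx_lin hTN K (c n)]
  change ∑ n, (Nat.card (WAnsIdx (WQuery.lin K (c n))) : ℝ) * _ = _
  simp only [h, sum_const, card_univ, Fintype.card_fin, nsmul_eq_mul]
  field_simp

theorem downloadBits_tWSJ_clean [NeZero N] {A : Type*} [AddCommGroup A] [Module F A]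
    (G : MDSFamily N T M F) (P : PMF (Fin M)) (k : Fin M) (s : Fin N) :
    (tWSJ hTN A G P).downloadBits (fun n => if n = s then .clean k else .null) =
      (N : ℝ) ^ M * Real.logb 2 (Nat.card A) := by
  change ∑ n, (Nat.card (WAnsIdx (if n = s then WQuery.clean k else .null : WQuery M N T F)) : ℝ) *
    _ = _
  rw [sum_eq_single s]
  · rw [if_pos rfl]
    simp [WAnsIdx]
  · intro n _ hn
    rw [if_neg hn]
    simp [WAnsIdx]
  · simp

/-- The download depends only on the coin, not on the desired file or the remaining randomness, so
its expectation is a two-term average. -/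
theorem rate_tWSJ [NeZero M] [NeZero N] (hM : 2 ≤ M) (A : Type*) [AddCommGroup A] [Module F A]
    [Finite A] [Nontrivial A] (G : MDSFamily N T M F) {p : ℝ} (h0 : 0 ≤ p) (h1 : p ≤ 1) :
    (tWSJ hTN A G (extremeLaw M p h0 h1)).rate =
      (1 + (1 - p) * ∑ i ∈ Icc 1 (M - 1), ((T : ℝ) / N) ^ i)⁻¹ := by
  set C := tWSJ hTN A G (extremeLaw M p h0 h1) with hC
  have hN : (N : ℝ) ≠ 0 := NeZero.ne _
  have hlog : Real.logb 2 (Nat.card A) ≠ 0 :=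
    (Real.logb_pos one_lt_two (by exact_mod_cast Finite.one_lt_card)).ne'
  have hgeom : ∑ i ∈ range M, ((T : ℝ) / N) ^ i =
      1 + ∑ i ∈ Icc 1 (M - 1), ((T : ℝ) / N) ^ i := by
    obtain ⟨m, rfl⟩ := Nat.exists_eq_add_of_le' (one_le_two.trans hM)
    rw [sum_range_succ', pow_zero, add_comm, Nat.add_sub_cancel]
    congr 1
    rw [range_eq_Ico, sum_Ico_add' (fun i => ((T : ℝ) / N) ^ i) 0 m 1]
    rfl
  have hexp : C.indexQueryLaw.expect (fun x => C.downloadBits x.2) =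
      (N : ℝ) ^ M * Real.logb 2 (Nat.card A) *
        (1 + (1 - p) * ∑ i ∈ Icc 1 (M - 1), ((T : ℝ) / N) ^ i) := by
    rw [IRScheme.indexQueryLaw, PMF.expect_bind]
    refine PMF.expect_const_of_support _ fun k _ => ?_
    rw [PMF.expect_map]
    let d : (Fin N → WQuery M N T F) → ℝ := C.downloadBits
    have hclean : ∀ s, d (fun n => if n = s then .clean k else .null) = _ :=
      downloadBits_tWSJ_clean hTN G _ k
    have hlin : ∀ c : Fin N → LinQuery N T F univ, d (fun n => .lin univ (c n)) = _ :=
      downloadBits_tWSJ_lin hTN G _ univ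
    change (wQueryLaw hTN G (extremeLaw M p h0 h1) k).expect d = _
    rw [wQueryLaw_extremeLaw hTN hM G h0 h1, PMF.expect_bind, expect_coinLaw, cond_true, cond_false,
      cleanLaw, sunJafarLaw, PMF.expect_map, PMF.expect_map]
    rw [PMF.expect_const_of_support _ fun s _ => hclean s,
      PMF.expect_const_of_support _ fun S _ => hlin _, card_univ,
      Fintype.card_fin, hgeom]
    ring
  rw [IRScheme.rate]
  change _ / C.indexQueryLaw.expect (fun x => C.downloadBits x.2) = _
  rw [hexp]
  push_cast
  rw [← div_div, div_self (mul_ne_zero (pow_ne_zero _ hN) hlog), one_div]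

end

end

/-! ### The choice of the clean-download probability -/

theorem theorem5 (M N T : ℕ) [NeZero M] [NeZero N] (hM : 2 ≤ M) (hT : 1 ≤ T) (hTN : T ≤ N) :
    ∃ q₀ : ℕ, ∀ ρ : ℝ, 0 ≤ ρ → ∃ P : PMF (Fin M),
      ∀ (F : Type*) [Field F] [Finite F] (A : Type*) [AddCommGroup A] [Module F A] [Finite A]
        [Nontrivial A], q₀ ≤ Nat.card F →
        Nonempty (MDSFamily N T M F) ∧
        ∀ G : MDSFamily N T M F,
          (tWSJ hTN A G P).Correct ∧
          (tWSJ hTN A G P).milLeakage T = min ρ (T * Real.logb 2 M / N) ∧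
          (tWSJ hTN A G P).rate =
            (1 + max 0 (1 - N * ρ / (T * Real.logb 2 M)) *
              ∑ i ∈ Finset.Icc 1 (M - 1), ((T : ℝ) / N) ^ i)⁻¹ := by
  have hN' : (0 : ℝ) < N := by exact_mod_cast NeZero.pos N
  have hT' : (0 : ℝ) < T := by exact_mod_cast hT
  have hlog : 0 < Real.logb 2 M := Real.logb_pos one_lt_two (by exact_mod_cast hM)
  refine ⟨maxCodeLength N T M, fun ρ hρ => ?_⟩
  -- This probability solves $p\frac TN\log M=\rho$, capped at $1$; it involves neither the field
  -- nor the codes.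
  have h0 : 0 ≤ min 1 (N * ρ / (T * Real.logb 2 M)) := le_min zero_le_one (by positivity)
  have h1 : min 1 (N * ρ / (T * Real.logb 2 M)) ≤ 1 := min_le_left _ _
  refine ⟨extremeLaw M _ h0 h1, ?_⟩
  intro F _ _ A _ _ _ _ hF
  refine ⟨nonempty_mdsFamily N T M F hF, fun G => ⟨tWSJ_correct hTN A G _, ?_, ?_⟩⟩
  · rw [milLeakage_tWSJ hTN hM A G h0 h1, mul_assoc, min_mul_of_nonneg _ _ (by positivity),
      min_comm]
    congr 1
    · field_simp
    · ring
  · rw [rate_tWSJ hTN hM A G h0 h1]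
    congr 3
    -- Uses $\max(1-x,1-1)=1-\min(x,1)$.
    rw [max_comm, ← sub_self (1 : ℝ), max_sub_sub_left, min_comm]
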